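/- Let $\omega^\omega$ be the Baire space with the product topology. A subset of a Polish space $X$ is boldface $\mathbf{\Sigma}^1_1$ if it is analytic; it is $\mathbf{\Pi}^1_n$ if its complement is $\mathbf{\Sigma}^1_n$, it is $\mathbf{\Sigma}^1_{n+1}$ if it is the projection to $X$ of a $\mathbf{\Pi}^1_n$ subset of $X\times\omega^\omega$, and it is $\mathbf{\Delta}^1_n$ if it is both $\mathbf{\Sigma}^1_n$ and $\mathbf{\Pi}^1_n$. A function $g:\omega^\omega\to\omega^\omega$ is $\mathbf{\Delta}^1_n$ if its graph is a $\mathbf{\Delta}^1_n$ subset of $\omega^\omega\times\omega^\omega$. A well-ordering $\le$ of $\omega^\omega$ (of any order type) is $\mathbf{\Sigma}^1_n$-good if $\le$ is $\mathbf{\Sigma}^1_n$ as a subset of $\omega^\omega\times\omega^\omega$ and, for every $\mathbf{\Sigma}^1_n$ relation $P\subseteq\omega^\omega\times\omega^\omega$, the relations $Q(x,y)\Leftrightarrow(\exists x'\le x)\,P(x',y)$ and $R(x,y)\Leftrightarrow(\forall x'\le x)\,P(x',y)$ are $\mathbf{\Sigma}^1_n$. Functions $g,h:\omega^\omega\to\omega^\omega$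 are disjoint if $g(x)\ne h(x)$ for all $x\in\omega^\omega$. Corollary. Let $\{f^a:a\in\omega^\omega\}$ be any family of functions from $\omega^\omega$ to $\omega^\omega$ such that the map $(a,x)\mapsto f^a(x)$ from $\omega^\omega\times\omega^\omega$ to $\omega^\omega$ is Borel. (1) If there is a $\mathbf{\Sigma}^1_2$-good well-ordering of $\omega^\omega$, then there is a $\mathbf{\Delta}^1_2$ function $g:\omega^\omega\to\omega^\omega$ such that the set of $a\in\omega^\omega$ for which $g$ is disjoint from $f^a$ is uncountable. (2) If there is a $\mathbf{\Sigma}^1_3$-good well-ordering of $\omega^\omega$, then there is a $\mathbf{\Delta}^1_3$ function $g:\omega^\omega\to\omega^\omega$ such that the set of $a\in\omega^\omega$ for which $g$ is disjoint from $f^a$ is uncountable. -/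

import Mathlib

/-- The Baire space `ω^ω`, with its product topology and its Borel σ-algebra. -/
abbrev BaireSpc : Type := ℕ → ℕ

/-- `IsBoldSigma n A`: the set `A` is boldface `Σ¹ₙ` in the space `X`.
`Σ¹₁` sets are the analytic sets, and a set is `Σ¹ₙ₊₁` iff it is the projection along `ω^ω`
of a `Π¹ₙ` subset of `X × ω^ω`. For `n = 0` the usual convention `Σ¹₀ = Σ⁰₁` is used. -/
def IsBoldSigma : (n : ℕ) → {X : Type} → [TopologicalSpace X] → Set X → Prop
  | 0, _, _, A => IsOpen A
  | 1, _, _, A => MeasureTheory.AnalyticSet A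
  | n + 2, X, _, A => ∃ B : Set (X × BaireSpc), IsBoldSigma (n + 1) Bᶜ ∧
      A = {x : X | ∃ y : BaireSpc, (x, y) ∈ B}

/-- Boldface `Π¹ₙ` sets: complements of boldface `Σ¹ₙ` sets. -/
def IsBoldPi (n : ℕ) {X : Type} [TopologicalSpace X] (A : Set X) : Prop :=
  IsBoldSigma n Aᶜ

/-- Boldface `Δ¹ₙ` sets: sets that are both `Σ¹ₙ` and `Π¹ₙ`. -/
def IsBoldDelta (n : ℕ) {X : Type} [TopologicalSpace X] (A : Set X) : Prop :=
  IsBoldSigma n A ∧ IsBoldPi n A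

/-- A function `g : ω^ω → ω^ω` is boldface `Δ¹ₙ` if its graph, the binary relation
`g(x) = y`, is boldface `Δ¹ₙ`. -/
def IsBoldDeltaFun (n : ℕ) (g : BaireSpc → BaireSpc) : Prop :=
  IsBoldDelta n {p : BaireSpc × BaireSpc | g p.1 = p.2}

/-- `le` is a (non-strict) well-ordering of `ω^ω`: a partial order such that every nonempty set
has a least element (in particular `le` is total). -/
structure IsWellOrdering (le : BaireSpc → BaireSpc → Prop) : Prop where
  refl : ∀ x, le x x
  trans : ∀ x y z, le x y → le y z → le x z
  antisymm : ∀ x y, le x y → le y x → x = y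
  exists_least : ∀ S : Set BaireSpc, S.Nonempty → ∃ m ∈ S, ∀ x ∈ S, le m x

/-- `le` is a boldface `Σ¹ₙ`-good well-ordering of `ω^ω`: it is boldface `Σ¹ₙ`, and the boldface
`Σ¹ₙ` binary relations are closed under both bounded quantifiers
`∃ x' ≤ x` and `∀ x' ≤ x`. -/
structure IsSigmaGood (n : ℕ) (le : BaireSpc → BaireSpc → Prop) : Prop where
  wellOrdering : IsWellOrdering le
  sigma : IsBoldSigma n {p : BaireSpc × BaireSpc | le p.1 p.2}
  bounded_exists : ∀ P : BaireSpc → BaireSpc → Prop,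
    IsBoldSigma n {p : BaireSpc × BaireSpc | P p.1 p.2} →
    IsBoldSigma n {p : BaireSpc × BaireSpc | ∃ x', le x' p.1 ∧ P x' p.2}
  bounded_forall : ∀ P : BaireSpc → BaireSpc → Prop,
    IsBoldSigma n {p : BaireSpc × BaireSpc | P p.1 p.2} →
    IsBoldSigma n {p : BaireSpc × BaireSpc | ∀ x', le x' p.1 → P x' p.2}

/-- `g` and `h` are disjoint (as sets of ordered pairs): they agree at no point. -/
def DisjointFun (g h : BaireSpc → BaireSpc) : Prop :=
  ∀ x, g x ≠ h x

open MeasureTheory Set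

section Instances

variable {X Y : Type} [TopologicalSpace X] [PolishSpace X] [TopologicalSpace Y] [PolishSpace Y]

/-! Split on whether every initial segment of the good well-ordering is countable. If `{a | le a
a₀}` is uncountable, let `g x` be the least `y` different from every `f a x` with `a ≤ a₀`. Such a
`y` exists by the hierarchy theorem (`exists_ne_of_le`), and goodness keeps the graph of `g` in
`Σ¹ₙ`. If all initial segments are countable, choose pairs `(g x, a_x)` by recursion along the
order. The value `g x` has a null fibre `{a | f a x = g x}` and differs from `f a_x' x` for `x' <
x`; then `a_x` avoids the null fibres at all `x' ≤ x` and the earlier indices. So `g` is disjoint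
from every `f a_x`. `exists_recursion` makes the least choice definable: a real can code the
countable history below `x`. -/

instance : PolishSpace BaireSpc := inferInstance

instance polishSpace_prod : PolishSpace (X × Y) := inferInstance

instance polishSpace_seq : PolishSpace (ℕ → X) := inferInstance

instance borelSpace_seq [MeasurableSpace X] [BorelSpace X] : BorelSpace (ℕ → X) := inferInstance

instance borelSpace_prod [MeasurableSpace X] [BorelSpace X] [MeasurableSpace Y] [BorelSpace Y] :
    BorelSpace (X × Y) := inferInstance

end Instances

/-! ### Closure properties of the projective classes, and universal sets. -/

namespace IsBoldSigma

section Borel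

variable {n : ℕ} {X Y : Type}
  [TopologicalSpace X] [PolishSpace X] [MeasurableSpace X] [BorelSpace X]
  [TopologicalSpace Y] [PolishSpace Y] [MeasurableSpace Y] [BorelSpace Y]

/-- Boldface `Σ¹ₙ` sets are closed under Borel preimages. -/
theorem preimage {A : Set Y} (hA : IsBoldSigma (n + 1) A) {f : X → Y} (hf : Measurable f) :
    IsBoldSigma (n + 1) (f ⁻¹' A) := by
  induction n generalizing X Y with
  | zero =>
    have hA' : AnalyticSet A := hA
    -- The preimage is the projection of `graph f ∩ (X × A)`, so a Borel graph suffices.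
    have h1 : AnalyticSet ((Prod.snd : X × Y → Y) ⁻¹' A) := hA'.preimage continuous_snd
    have h2 : AnalyticSet {p : X × Y | f p.1 = p.2} :=
      (measurableSet_eq_fun (hf.comp measurable_fst) measurable_snd).analyticSet
    have h3 : AnalyticSet ({p : X × Y | f p.1 = p.2} ∩ Prod.snd ⁻¹' A) := by
      have := AnalyticSet.iInter (ι := Bool)
        (s := fun b => bif b then {p : X × Y | f p.1 = p.2} else Prod.snd ⁻¹' A)
        (by rintro (_ | _) <;> assumption)
      convert this using 1
      ext p
      simp [and_comm]
    have h4 := h3.image_of_continuous continuous_fst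
    change AnalyticSet (f ⁻¹' A)
    convert h4 using 1
    ext x
    simp
  | succ n ih =>
    obtain ⟨B, hB, rfl⟩ := hA
    refine ⟨(Prod.map f id) ⁻¹' B, ?_, rfl⟩
    exact ih (A := Bᶜ) hB (hf.prodMap measurable_id)

end Borel

section Polish

variable {n : ℕ} {X : Type} [TopologicalSpace X] [PolishSpace X]

theorem iUnion_and_iInter (n : ℕ) :
    ∀ {X : Type} [TopologicalSpace X] [PolishSpace X] {A : ℕ → Set X},
    (∀ i, IsBoldSigma (n + 1) (A i)) →
      IsBoldSigma (n + 1) (⋃ i, A i) ∧ IsBoldSigma (n + 1) (⋂ i, A i) := by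
  induction n with
  | zero => exact fun hA => ⟨AnalyticSet.iUnion hA, AnalyticSet.iInter hA⟩
  | succ n ih =>
    intro X _ _ A hA
    borelize X
    choose B hB hAB using hA
    -- For the intersection, one real codes a witness for each `i` through `Nat.pair`.
    refine ⟨⟨⋃ i, B i, ?_, ?_⟩, ⟨⋂ i, {p | (p.1, fun k => p.2 (Nat.pair i k)) ∈ B i}, ?_, ?_⟩⟩
    · rw [compl_iUnion]
      exact (ih hB).2
    · ext x
      simp only [hAB, mem_iUnion, mem_ofPred_eq]
      exact exists_comm
    · rw [compl_iInter]
      refine (ih fun i => ?_).1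
      exact (hB i).preimage (f := fun p : X × BaireSpc => (p.1, fun k => p.2 (Nat.pair i k)))
        (by fun_prop)
    · ext x
      simp only [hAB, mem_iInter, mem_ofPred_eq]
      refine ⟨fun h => ?_, fun ⟨y, hy⟩ i => ⟨_, hy i⟩⟩
      choose y hy using h
      exact ⟨fun m => y m.unpair.1 m.unpair.2, fun i => by simpa using hy i⟩

theorem exists_nat {P : ℕ → X → Prop} (h : ∀ i, IsBoldSigma (n + 1) {x | P i x}) :
    IsBoldSigma (n + 1) {x | ∃ i, P i x} := by
  simpa only [ofPred_exists] using (iUnion_and_iInter n h).1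

theorem forall_nat {P : ℕ → X → Prop} (h : ∀ i, IsBoldSigma (n + 1) {x | P i x}) :
    IsBoldSigma (n + 1) {x | ∀ i, P i x} := by
  simpa only [ofPred_forall] using (iUnion_and_iInter n h).2

theorem or {P Q : X → Prop} (hP : IsBoldSigma (n + 1) {x | P x})
    (hQ : IsBoldSigma (n + 1) {x | Q x}) : IsBoldSigma (n + 1) {x | P x ∨ Q x} := by
  have := exists_nat (P := fun i x => (i = 0 ∧ P x) ∨ (i ≠ 0 ∧ Q x)) (n := n) (by
    intro i
    by_cases hi : i = 0 <;> simpa [hi])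
  convert this using 3 with x
  exact ⟨fun h => h.elim (fun h => ⟨0, .inl ⟨rfl, h⟩⟩) fun h => ⟨1, .inr ⟨one_ne_zero, h⟩⟩,
    fun ⟨_, h⟩ => h.imp And.right And.right⟩

theorem and {P Q : X → Prop} (hP : IsBoldSigma (n + 1) {x | P x})
    (hQ : IsBoldSigma (n + 1) {x | Q x}) : IsBoldSigma (n + 1) {x | P x ∧ Q x} := by
  have := forall_nat (P := fun i x => (i = 0 → P x) ∧ (i ≠ 0 → Q x)) (n := n) (by
    intro i
    by_cases hi : i = 0 <;> simpa [hi])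
  convert this using 3 with x
  exact ⟨fun h _ => ⟨fun _ => h.1, fun _ => h.2⟩,
    fun h => ⟨(h 0).1 rfl, (h 1).2 one_ne_zero⟩⟩

theorem exists_isClosed_of_analyticSet {A : Set X} (hA : AnalyticSet A) :
    ∃ C : Set (X × BaireSpc), IsClosed C ∧ A = {x | ∃ y, (x, y) ∈ C} := by
  rw [AnalyticSet] at hA
  obtain rfl | ⟨f, hf, rfl⟩ := hA
  · exact ⟨∅, isClosed_empty, by simp⟩
  · exact ⟨{p | f p.2 = p.1}, isClosed_eq (by fun_prop) (by fun_prop), rfl⟩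

/-- The boldface hierarchy is increasing. -/
theorem mono_succ (n : ℕ) : ∀ {X : Type} [TopologicalSpace X] [PolishSpace X] {A : Set X},
    IsBoldSigma (n + 1) A → IsBoldSigma (n + 2) A := by
  induction n with
  | zero =>
    intro X _ _ A hA
    obtain ⟨C, hC, rfl⟩ := exists_isClosed_of_analyticSet hA
    borelize X
    exact ⟨C, hC.isOpen_compl.measurableSet.analyticSet, rfl⟩
  | succ n ih =>
    rintro X _ _ A ⟨B, hB, rfl⟩
    exact ⟨B, ih hB, rfl⟩

/-- A universal closed set. -/
theorem exists_universal_isClosed (X : Type) [TopologicalSpace X] [SecondCountableTopology X] :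
    ∃ F : Set (BaireSpc × X), IsClosed F ∧
      ∀ C : Set X, IsClosed C → ∃ e, C = {x | (e, x) ∈ F} := by
  classical
  obtain ⟨b, hbc, -, hb⟩ := TopologicalSpace.exists_countable_basis X
  -- Adding `∅` makes the family nonempty, so that it has an enumeration.
  obtain ⟨u, hu⟩ := (hbc.insert ∅).exists_eq_range (insert_nonempty _ _)
  have huo : ∀ i, IsOpen (u i) := fun i => by
    have : u i ∈ insert ∅ b := hu ▸ mem_range_self i
    obtain h | h := this
    · rw [h]; exact isOpen_empty
    · exact hb.isOpen h
  -- The code of `C` marks the basic open sets that miss `C`.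
  refine ⟨⋂ i, {p | p.1 i ≠ 0 ∧ p.2 ∈ u i}ᶜ, isClosed_iInter fun i => IsOpen.isClosed_compl ?_,
    fun C hC => ⟨fun i => if u i ⊆ Cᶜ then 1 else 0, ?_⟩⟩
  · exact (isOpen_discrete {m : ℕ | m ≠ 0} |>.preimage
      (f := fun p : BaireSpc × X => p.1 i) (by fun_prop)).inter ((huo i).preimage continuous_snd)
  · ext x
    simp only [mem_ofPred_eq, mem_iInter, mem_compl_iff, not_and, ite_eq_right_iff, one_ne_zero,
      imp_false, ne_eq, not_not]
    refine ⟨fun hx i hi hxi => hi hxi hx, fun h => ?_⟩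
    by_contra hx
    obtain ⟨v, hv, hxv, hvC⟩ := hb.exists_subset_of_mem_open hx hC.isOpen_compl
    obtain ⟨i, rfl⟩ : v ∈ range u := hu ▸ mem_insert_of_mem _ hv
    exact h i hvC hxv

/-- Universal boldface `Σ¹ₙ` sets. -/
theorem exists_universal (n : ℕ) : ∀ (X : Type) [TopologicalSpace X] [PolishSpace X],
    ∃ U : Set (BaireSpc × X), IsBoldSigma (n + 1) U ∧
      ∀ A : Set X, IsBoldSigma (n + 1) A → ∃ e, A = {x | (e, x) ∈ U} := by
  induction n with
  | zero =>
    intro X _ _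
    obtain ⟨F, hF, hFu⟩ := exists_universal_isClosed (X × BaireSpc)
    refine ⟨(fun p : BaireSpc × X × BaireSpc => (p.1, p.2.1)) '' F,
      hF.analyticSet.image_of_continuous (by fun_prop), fun A hA => ?_⟩
    obtain ⟨C, hC, rfl⟩ := exists_isClosed_of_analyticSet hA
    obtain ⟨e, rfl⟩ := hFu C hC
    exact ⟨e, by ext x; simp⟩
  | succ n ih =>
    intro X _ _
    borelize X
    obtain ⟨U, hU, hUu⟩ := ih (X × BaireSpc)
    refine ⟨{p | ∃ y, (p.1, p.2, y) ∉ U}, ⟨{q | (q.1.1, q.1.2, q.2) ∉ U}, ?_, rfl⟩, ?_⟩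
    · convert hU.preimage (f := fun q : (BaireSpc × X) × BaireSpc => (q.1.1, q.1.2, q.2))
        (by fun_prop) using 1
      ext q
      simp
    · rintro A ⟨B, hB, rfl⟩
      obtain ⟨e, he⟩ := hUu _ hB
      refine ⟨e, ?_⟩
      ext x
      have : ∀ y, (x, y) ∈ B ↔ (e, x, y) ∉ U := fun y => by
        rw [← not_iff_not, ← mem_compl_iff, he]
        simp
      simp [this]

/-- The hierarchy theorem: some boldface `Σ¹ₙ` set is not boldface `Π¹ₙ`. -/
theorem exists_not_compl (n : ℕ) :
    ∃ A : Set BaireSpc, IsBoldSigma (n + 1) A ∧ ¬ IsBoldSigma (n + 1) Aᶜ := by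
  obtain ⟨U, hU, hUu⟩ := exists_universal n BaireSpc
  refine ⟨{e | (e, e) ∈ U}, hU.preimage (f := fun e => (e, e)) (by fun_prop), fun h => ?_⟩
  obtain ⟨e, he⟩ := hUu _ h
  have : e ∈ {e | (e, e) ∈ U}ᶜ ↔ e ∈ {x | (e, x) ∈ U} := by rw [he]
  simp at this

theorem _root_.MeasurableSet.isBoldSigma [MeasurableSpace X] [BorelSpace X] {A : Set X}
    (hA : MeasurableSet A) (n : ℕ) : IsBoldSigma (n + 1) A := by
  induction n with
  | zero => exact hA.analyticSet
  | succ n ih => exact mono_succ n ih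

end Polish

section Borel

variable {n : ℕ} {X Y : Type}
  [TopologicalSpace X] [PolishSpace X] [MeasurableSpace X] [BorelSpace X]
  [TopologicalSpace Y] [PolishSpace Y] [MeasurableSpace Y] [BorelSpace Y]

/-- Boldface `Σ¹ₙ` sets are closed under projections along `ω^ω`. -/
theorem exists_baire {P : BaireSpc → X → Prop}
    (h : IsBoldSigma (n + 1) {p : X × BaireSpc | P p.2 p.1}) :
    IsBoldSigma (n + 1) {x | ∃ y, P y x} := by
  cases n with
  | zero =>
    have h' : AnalyticSet {p : X × BaireSpc | P p.2 p.1} := h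
    change AnalyticSet _
    convert h'.image_of_continuous continuous_fst using 1
    ext x
    simp
  | succ n =>
    obtain ⟨B, hB, hPB⟩ := h
    -- Two successive real witnesses are merged into the even and odd parts of one.
    refine ⟨{q | ((q.1, fun k => q.2 (2 * k)), fun k => q.2 (2 * k + 1)) ∈ B},
      hB.preimage (f := fun q : X × BaireSpc =>
        ((q.1, fun k => q.2 (2 * k)), fun k => q.2 (2 * k + 1))) (by fun_prop), ?_⟩
    ext x
    have key : ∀ y, P y x ↔ ∃ z, ((x, y), z) ∈ B := fun y => by
      change (x, y) ∈ {p : X × BaireSpc | P p.2 p.1} ↔ _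
      rw [hPB]
      rfl
    simp only [mem_ofPred_eq, key]
    refine ⟨fun ⟨y, z, hyz⟩ => ⟨fun m => if m % 2 = 0 then y (m / 2) else z (m / 2), ?_⟩,
      fun ⟨q, hq⟩ => ⟨_, _, hq⟩⟩
    convert hyz using 4 with k k
    · simp
    · simp only [Nat.mul_add_mod_self_left, Nat.one_mod, one_ne_zero, if_false]
      congr 1
      omega

theorem baire_not_countable : ¬ Countable BaireSpc := by
  intro h
  obtain ⟨e, he⟩ := exists_surjective_nat BaireSpc
  obtain ⟨m, hm⟩ := he fun k => e k k + 1
  have := congrFun hm m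
  omega

/-- Boldface `Σ¹ₙ` sets are closed under projections along uncountable Polish spaces. -/
theorem exists_polish (hY : ¬ Countable Y) {P : Y → X → Prop}
    (h : IsBoldSigma (n + 1) {p : X × Y | P p.2 p.1}) :
    IsBoldSigma (n + 1) {x | ∃ y, P y x} := by
  let e : BaireSpc ≃ᵐ Y := PolishSpace.measurableEquivOfNotCountable baire_not_countable hY
  have := exists_baire (n := n) (P := fun z x => P (e z) x)
    (h.preimage (f := fun p : X × BaireSpc => (p.1, e p.2)) (by fun_prop))
  convert this using 3 with x
  exact ⟨fun ⟨y, hy⟩ => ⟨e.symm y, by simpa using hy⟩, fun ⟨z, hz⟩ => ⟨_, hz⟩⟩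

end Borel

end IsBoldSigma

/-- A function with a boldface `Σ¹ₙ` graph is boldface `Δ¹ₙ`. -/
theorem IsBoldDeltaFun.of_graph {n : ℕ} {g : BaireSpc → BaireSpc}
    (hg : IsBoldSigma (n + 1) {p : BaireSpc × BaireSpc | g p.1 = p.2}) :
    IsBoldDeltaFun (n + 1) g := by
  refine ⟨hg, ?_⟩
  -- Off the graph, some other `y` is the value: this makes the complement a projection too.
  have h := IsBoldSigma.exists_baire (n := n) (X := BaireSpc × BaireSpc)
    (P := fun y p => g p.1 = y ∧ y ≠ p.2) (IsBoldSigma.and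
      (hg.preimage (f := fun q : (BaireSpc × BaireSpc) × BaireSpc => (q.1.1, q.2)) (by fun_prop))
      (((measurableSet_eq_fun measurable_snd
        (measurable_snd.comp measurable_fst)).compl).isBoldSigma n))
  change IsBoldSigma (n + 1) _
  convert h using 1
  ext p
  simp

/-! ### Least elements of well-orderings. -/

namespace IsWellOrdering

variable {le : BaireSpc → BaireSpc → Prop} (hle : IsWellOrdering le)
include hle

theorem total (x y : BaireSpc) : le x y ∨ le y x := by
  obtain ⟨m, rfl | rfl, hm⟩ := hle.exists_least {x, y} (insert_nonempty _ _)
  · exact .inl (hm y (by simp))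
  · exact .inr (hm x (by simp))

theorem not_le {x y : BaireSpc} : ¬ le x y ↔ le y x ∧ y ≠ x :=
  ⟨fun h => ⟨(hle.total x y).resolve_left h, fun e => h (e ▸ hle.refl y)⟩,
    fun h h' => h.2 (hle.antisymm _ _ h.1 h')⟩

theorem wellFounded_lt : WellFounded fun x y => le x y ∧ x ≠ y := by
  refine WellFounded.wellFounded_iff_has_min.2 fun S hS => ?_
  obtain ⟨m, hm, h⟩ := hle.exists_least S hS
  exact ⟨m, hm, fun x hx hxm => hxm.2 (hle.antisymm _ _ hxm.1 (h x hx))⟩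

/-- Leastness is written as a quantifier bounded by `x`, the form that `forall_le` handles once the
complement of `S` is `Σ¹ₙ`. -/
theorem least_unique {S : BaireSpc → Prop} {x y : BaireSpc}
    (hx : S x ∧ ∀ c, le c x → c = x ∨ ¬ S c) (hy : S y ∧ ∀ c, le c y → c = y ∨ ¬ S c) :
    x = y := by
  rcases hle.total x y with h | h
  · exact (hy.2 x h).resolve_right (not_not.2 hx.1)
  · exact ((hx.2 y h).resolve_right (not_not.2 hy.1)).symm

theorem exists_isLeast {S : BaireSpc → Prop} (hS : ∃ x, S x) :
    ∃ x, S x ∧ ∀ c, le c x → c = x ∨ ¬ S c := by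
  obtain ⟨m, hm, h⟩ := hle.exists_least {x | S x} hS
  exact ⟨m, hm, fun c hc => or_iff_not_imp_right.2 fun hSc =>
    hle.antisymm _ _ hc (h c (not_not.1 hSc))⟩

end IsWellOrdering

/-! ### Bounded quantifiers, and the case of an uncountable initial segment. -/

namespace IsSigmaGood

variable {n : ℕ} {le : BaireSpc → BaireSpc → Prop} {X : Type}
  [TopologicalSpace X] [PolishSpace X] [MeasurableSpace X] [BorelSpace X]

theorem le_comp (hle : IsSigmaGood (n + 1) le) {f g : X → BaireSpc}
    (hf : Measurable f) (hg : Measurable g) : IsBoldSigma (n + 1) {x | le (f x) (g x)} :=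
  hle.sigma.preimage (f := fun x => (f x, g x)) (hf.prodMk hg)

/-- A Borel isomorphism with `ω^ω` carries goodness over to parameters in any uncountable Polish
space. -/
theorem forall_le (hle : IsSigmaGood (n + 1) le) (hX : ¬ Countable X) {f : X → BaireSpc}
    (hf : Measurable f) {P : BaireSpc → X → Prop}
    (hP : IsBoldSigma (n + 1) {p : X × BaireSpc | P p.2 p.1}) :
    IsBoldSigma (n + 1) {x | ∀ c, le c (f x) → P c x} := by
  let e : X ≃ᵐ BaireSpc :=
    PolishSpace.measurableEquivOfNotCountable hX IsBoldSigma.baire_not_countable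
  have h := hle.bounded_forall (fun c y => P c (e.symm y))
    (hP.preimage (f := fun p : BaireSpc × BaireSpc => (e.symm p.2, p.1)) (by fun_prop))
  have h' := h.preimage (f := fun x => (f x, e x)) (by fun_prop)
  convert h' using 1
  ext x
  simp

/-- If some initial segment mapped onto `ω^ω` by a Borel map, boldface `Σ¹ₙ` would be closed under
`∀ y ∈ ω^ω`, against the hierarchy theorem. -/
theorem exists_ne_of_le (hle : IsSigmaGood (n + 2) le) (a₀ : BaireSpc) {φ : BaireSpc → BaireSpc}
    (hφ : Measurable φ) : ∃ y, ∀ a, le a a₀ → φ a ≠ y := by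
  by_contra! hsurj
  obtain ⟨A, ⟨B, hB, rfl⟩, hA⟩ := IsBoldSigma.exists_not_compl (n + 1)
  refine hA ?_
  -- Surjectivity turns `∀ y` into `∀ a ≤ a₀`; the matrix `Bᶜ` comes from one level below.
  have h := hle.forall_le IsBoldSigma.baire_not_countable (f := fun _ => a₀) measurable_const
    (P := fun a x => (x, φ a) ∉ B)
    ((IsBoldSigma.mono_succ n hB).preimage
      (f := fun p : BaireSpc × BaireSpc => (p.1, φ p.2)) (by fun_prop))
  convert h using 1
  ext x
  simp only [mem_compl_iff, mem_ofPred_eq, not_exists]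
  refine ⟨fun h c _ => h _, fun h y => ?_⟩
  obtain ⟨a, ha, rfl⟩ := hsurj y
  exact h a ha

/-- The case where some initial segment is uncountable. -/
theorem exists_disjointFun_of_not_countable (hle : IsSigmaGood (n + 2) le) {a₀ : BaireSpc}
    (ha₀ : ¬ {a | le a a₀}.Countable) {f : BaireSpc → BaireSpc → BaireSpc}
    (hf : Measurable fun p : BaireSpc × BaireSpc => f p.1 p.2) :
    ∃ g, IsBoldDeltaFun (n + 2) g ∧ ¬ {a | DisjointFun g (f a)}.Countable := by
  have hwo := hle.wellOrdering
  have hf' : ∀ {Z : Type} [MeasurableSpace Z] {u v : Z → BaireSpc}, Measurable u → Measurable v →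
      Measurable fun z => f (u z) (v z) := fun hu hv => hf.comp (hu.prodMk hv)
  choose g hg hg' using fun x => hwo.exists_isLeast
    (hle.exists_ne_of_le a₀ (φ := fun a => f a x) (hf' measurable_id measurable_const))
  have hunc : ¬ Countable (BaireSpc × BaireSpc) := fun _ =>
    IsBoldSigma.baire_not_countable
      (Function.Injective.countable (f := fun x : BaireSpc => (x, x)) fun _ _ h => (Prod.ext_iff.1 h).1)
  refine ⟨g, IsBoldDeltaFun.of_graph ?_, fun h => ha₀ (h.mono ?_)⟩
  swap
  · exact fun a ha x hx => hg x a ha hx.symm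
  -- The negated `∀ a ≤ a₀` becomes an existential, so only `Σ¹ₙ` operations remain.
  have key : {p : BaireSpc × BaireSpc | g p.1 = p.2} =
      {p | (∀ a, le a a₀ → f a p.1 ≠ p.2) ∧
        ∀ c, le c p.2 → c = p.2 ∨ ∃ a, le a a₀ ∧ f a p.1 = c} := by
    ext ⟨x, y⟩
    have hnot : ∀ c, (∃ a, le a a₀ ∧ f a x = c) ↔ ¬ ∀ a, le a a₀ → f a x ≠ c := by
      intro c; push Not; rfl
    simp only [mem_ofPred_eq, hnot]
    exact ⟨fun h => h ▸ ⟨hg x, hg' x⟩, fun h => hwo.least_unique ⟨hg x, hg' x⟩ h⟩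
  rw [key]
  refine .and (hle.forall_le hunc measurable_const (P := fun a p => f a p.1 ≠ p.2) ?_)
    (hle.forall_le hunc measurable_snd
      (P := fun c p => c = p.2 ∨ ∃ a, le a a₀ ∧ f a p.1 = c) (.or ?_ (.exists_baire (.and ?_ ?_))))
  · exact (measurableSet_eq_fun (hf' (by fun_prop) (by fun_prop))
      (by fun_prop)).compl.isBoldSigma _
  · exact (measurableSet_eq_fun (by fun_prop) (by fun_prop)).isBoldSigma _
  · exact hle.le_comp measurable_snd measurable_const
  · exact (measurableSet_eq_fun (hf' (by fun_prop) (by fun_prop)) (by fun_prop)).isBoldSigma _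

/-! ### Definable recursion along a good well-ordering. -/

/-- Sequences of pairs of reals, as codes of countable partial functions. -/
abbrev BairePairSeq : Type := ℕ → BaireSpc × BaireSpc

instance : BorelSpace BairePairSeq := borelSpace_seq

instance : BorelSpace ((BaireSpc × BaireSpc) × BairePairSeq) := borelSpace_prod

/-- Definable recursion of length `ω₁`: if every initial segment of the good well-ordering is
countable, then a Borel condition on `h x` and on the pairs `h x`, `h x'` with `x' < x` which can be
met at every step is met by some `h` with a boldface `Σ¹ₙ` graph. -/
theorem exists_recursion (hle : IsSigmaGood (n + 1) le) (hcount : ∀ x, {a | le a x}.Countable)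
    {U : BaireSpc → BaireSpc → Prop} {V : BaireSpc → BaireSpc → BaireSpc → BaireSpc → Prop}
    (hU : MeasurableSet {p : BaireSpc × BaireSpc | U p.1 p.2})
    (hV : MeasurableSet {p : (BaireSpc × BaireSpc) × BaireSpc × BaireSpc |
      V p.1.1 p.1.2 p.2.1 p.2.2})
    (hstep : ∀ x (S : Set BaireSpc) (h : BaireSpc → BaireSpc), S.Countable →
      (∀ x' ∈ S, U x' (h x')) → ∃ c, U x c ∧ ∀ x' ∈ S, V x c x' (h x')) :
    ∃ h : BaireSpc → BaireSpc,
      IsBoldSigma (n + 1) {p : BaireSpc × BaireSpc | h p.1 = p.2} ∧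
      (∀ x, U x (h x)) ∧ ∀ x x', le x' x → x' ≠ x → V x (h x) x' (h x') := by
  classical
  have hwo := hle.wellOrdering
  let T : BaireSpc → (BaireSpc → BaireSpc) → BaireSpc → Prop := fun x h c =>
    U x c ∧ ∀ x', le x' x ∧ x' ≠ x → V x c x' (h x')
  have hrec : ∃ h : BaireSpc → BaireSpc, ∀ x, T x h (h x) ∧ ∀ c, le c (h x) → c = h x ∨ ¬ T x h c := by
    -- The premise on `r` lets the step be defined on every history; induction (`hUh`) shows that
    -- the actual histories satisfy it.
    have hT : ∀ (x : BaireSpc) (r : ∀ x', le x' x ∧ x' ≠ x → BaireSpc), ∃ c,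
        (∀ x' hx', U x' (r x' hx')) →
        (U x c ∧ ∀ x' hx', V x c x' (r x' hx')) ∧
          ∀ d, le d c → d = c ∨ ¬ (U x d ∧ ∀ x' hx', V x d x' (r x' hx')) := by
      intro x r
      by_cases hr : ∀ x' hx', U x' (r x' hx')
      · obtain ⟨c, hc⟩ := hstep x {x' | le x' x ∧ x' ≠ x}
          (fun x' => if hx' : le x' x ∧ x' ≠ x then r x' hx' else x)
          ((hcount x).mono fun _ h => h.1)
          (fun x' hx' => by simpa [show le x' x ∧ x' ≠ x from hx'] using hr x' hx')
        obtain ⟨d, hd⟩ := hwo.exists_isLeast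
          (S := fun c => U x c ∧ ∀ x' hx', V x c x' (r x' hx'))
          ⟨c, hc.1, fun x' hx' => by simpa [hx'] using hc.2 x' hx'⟩
        exact ⟨d, fun _ => hd⟩
      · exact ⟨x, fun h => absurd h hr⟩
    choose F hF using hT
    let h : BaireSpc → BaireSpc := hwo.wellFounded_lt.fix F
    have hh : ∀ x, h x = F x fun x' _ => h x' := fun x => hwo.wellFounded_lt.fix_eq F x
    have hUh : ∀ x, U x (h x) := fun x => by
      induction x using hwo.wellFounded_lt.induction with | _ x ih
      rw [hh]
      exact (hF x _ ih).1.1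
    refine ⟨h, fun x => ?_⟩
    have := hF x (fun x' _ => h x') (fun x' _ => hUh x')
    rwa [← hh] at this
  obtain ⟨h, hh⟩ := hrec
  refine ⟨h, ?_, fun x => (hh x).1.1, fun x x' h₁ h₂ => (hh x).1.2 x' ⟨h₁, h₂⟩⟩
  have hS : ¬ Countable BairePairSeq := fun _ => IsBoldSigma.baire_not_countable
    (Function.Injective.countable (f := fun (x : BaireSpc) => (fun _ => (x, x) : BairePairSeq))
      fun _ _ h => (Prod.ext_iff.1 (congrFun h 0)).1)
  -- `Q` is `T` read off the history `s`. Its order clause is "not below, or `V`", so both `Q` and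
  -- its negation are `Σ¹ₙ`.
  let Q : BairePairSeq → ℕ → BaireSpc → Prop := fun s i c =>
    U (s i).1 c ∧ ∀ j, le (s i).1 (s j).1 ∨ V (s i).1 c (s j).1 (s j).2
  -- The witness `s` enumerates the graph of `h` up to `p.1`, which is possible because this segment
  -- is countable.
  have key : {p : BaireSpc × BaireSpc | h p.1 = p.2} = {p | ∃ s : BairePairSeq,
      (∀ i, le (s i).1 p.1) ∧ (∀ x', le x' p.1 → ∃ i, (s i).1 = x') ∧
      (∃ i, s i = p) ∧ ∀ i, Q s i (s i).2 ∧ ∀ c, le c (s i).2 → c = (s i).2 ∨ ¬ Q s i c} := by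
    have hQT : ∀ (s : BairePairSeq) (x : BaireSpc), (∀ x', le x' x → ∃ i, (s i).1 = x') → ∀ i,
        le (s i).1 x → (∀ j, le (s j).1 (s i).1 ∧ (s j).1 ≠ (s i).1 → (s j).2 = h (s j).1) →
        Q s i = T (s i).1 h := by
      intro s x hs i hi hj
      ext c
      refine and_congr_right fun _ => ⟨fun H x' hx' => ?_, fun H j => ?_⟩
      · obtain ⟨j, rfl⟩ := hs x' (hwo.trans _ _ _ hx'.1 hi)
        rw [← hj j hx']
        exact (H j).resolve_left (hwo.not_le.2 hx')
      · refine or_iff_not_imp_left.2 fun hn => ?_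
        rw [hj j (hwo.not_le.1 hn)]
        exact H _ (hwo.not_le.1 hn)
    ext ⟨x, y⟩
    simp only [mem_ofPred_eq]
    constructor
    · rintro rfl
      obtain ⟨z, hz⟩ := (hcount x).exists_eq_range ⟨x, hwo.refl x⟩
      have hzx : ∀ i, le (z i) x := fun i => hz.ge (mem_range_self i)
      have hz' : ∀ x', le x' x → ∃ i, z i = x' := fun x' hx' => hz.le hx'
      refine ⟨fun i => (z i, h (z i)), hzx, hz', ?_, fun i => ?_⟩
      · obtain ⟨i, hi⟩ := hz' x (hwo.refl x)
        exact ⟨i, by simp [hi]⟩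
      · rw [hQT (fun i => (z i, h (z i))) x hz' i (hzx i) fun _ _ => rfl]
        exact hh (z i)
    · rintro ⟨s, hsx, hs, ⟨i, hi⟩, hQ⟩
      -- Any locally correct history agrees with `h`, by induction and uniqueness of least choices.
      have hsh : ∀ x', ∀ i, (s i).1 = x' → (s i).2 = h x' := fun x' => by
        induction x' using hwo.wellFounded_lt.induction with | _ x' ih
        rintro i rfl
        have := hQ i
        rw [hQT s x hs i (hsx i) fun j hj => ih _ hj j rfl] at this
        exact hwo.least_unique this (hh _)
      have := hsh x i (by rw [hi])
      rw [← this, hi]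
  rw [key]
  have hunc : ∀ (X : Type) (x : X), ¬ Countable (X × BairePairSeq) := fun X x _ =>
    hS (Function.Injective.countable (f := fun s : BairePairSeq => (x, s)) fun _ _ h => (Prod.ext_iff.1 h).2)
  have hle' : ∀ {Z : Type} [TopologicalSpace Z] [PolishSpace Z] [MeasurableSpace Z] [BorelSpace Z]
      {s : Z → BairePairSeq} {c : Z → BaireSpc} (i : ℕ), Measurable s → Measurable c →
      IsBoldSigma (n + 1) {z | Q (s z) i (c z)} ∧ IsBoldSigma (n + 1) {z | ¬ Q (s z) i (c z)} := by
    intro Z _ _ _ _ s c i hs hc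
    have hs' : ∀ j, Measurable fun z => s z j := fun j => (measurable_pi_apply j).comp hs
    have hU' : MeasurableSet {z | U (s z i).1 (c z)} :=
      hU.preimage ((hs' i).fst.prodMk hc)
    have hV' : ∀ j, MeasurableSet {z | V (s z i).1 (c z) (s z j).1 (s z j).2} := fun j =>
      hV.preimage (f := fun z => (((s z i).1, c z), s z j)) (((hs' i).fst.prodMk hc).prodMk (hs' j))
    constructor
    · exact .and (hU'.isBoldSigma n) (.forall_nat fun j =>
        .or (hle.le_comp (hs' i).fst (hs' j).fst) ((hV' j).isBoldSigma n))
    · have : {z | ¬ Q (s z) i (c z)} = {z | ¬ U (s z i).1 (c z) ∨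
          ∃ j, (le (s z j).1 (s z i).1 ∧ (s z j).1 ≠ (s z i).1) ∧
            ¬ V (s z i).1 (c z) (s z j).1 (s z j).2} := by
        ext z
        simp only [Q, mem_ofPred_eq, not_and_or, not_forall, not_or, hwo.not_le]
      rw [this]
      exact .or (hU'.compl.isBoldSigma n) (.exists_nat fun j => .and (.and
        (hle.le_comp (hs' j).fst (hs' i).fst)
        ((measurableSet_eq_fun (hs' j).fst (hs' i).fst).compl.isBoldSigma n))
        ((hV' j).compl.isBoldSigma n))
  refine .exists_polish hS (P := fun s p => (∀ i, le (s i).1 p.1) ∧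
      (∀ x', le x' p.1 → ∃ i, (s i).1 = x') ∧ (∃ i, s i = p) ∧
      ∀ i, Q s i (s i).2 ∧ ∀ c, le c (s i).2 → c = (s i).2 ∨ ¬ Q s i c)
    (.and (.forall_nat fun i => ?_) (.and ?_ (.and (.exists_nat fun i => ?_)
      (.forall_nat fun i => .and ?_ ?_))))
  · exact hle.le_comp (by fun_prop) (by fun_prop)
  · refine hle.forall_le (hunc _ default) (by fun_prop) (P := fun x' q => ∃ i, (q.2 i).1 = x')
      (.exists_nat fun i => ?_)
    exact (measurableSet_eq_fun (by fun_prop) (by fun_prop)).isBoldSigma n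
  · exact (measurableSet_eq_fun (by fun_prop) (by fun_prop)).isBoldSigma n
  · exact (hle' i (by fun_prop) (by fun_prop)).1
  · refine hle.forall_le (hunc _ default) (f := fun q => (q.2 i).2) (by fun_prop)
      (P := fun c q => c = (q.2 i).2 ∨ ¬ Q q.2 i c) (.or ?_ ?_)
    · exact (measurableSet_eq_fun (by fun_prop) (by fun_prop)).isBoldSigma n
    · exact (hle' i (by fun_prop) (by fun_prop)).2

end IsSigmaGood

/-! ### The case of countable initial segments, and the conclusion. -/

/-- There is a nonzero atomless `σ`-finite Borel measure on the Baire space. -/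
theorem exists_noAtoms_measure_baire :
    ∃ μ : Measure BaireSpc, SFinite μ ∧ NullSingletonClass μ ∧ μ univ ≠ 0 := by
  let e : ℝ ≃ᵐ BaireSpc := PolishSpace.measurableEquivOfNotCountable
    (fun h => Cardinal.not_countable_real (countable_univ_iff.2 h)) IsBoldSigma.baire_not_countable
  refine ⟨volume.map e, inferInstance, ⟨fun y => ?_⟩, ?_⟩
  · rw [e.map_apply, ← e.image_symm, image_singleton, measure_singleton]
  · simp [e.map_apply]

namespace IsSigmaGood

variable {n : ℕ} {le : BaireSpc → BaireSpc → Prop}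

/-- The case where all initial segments are countable. -/
theorem exists_disjointFun_of_countable (hle : IsSigmaGood (n + 1) le)
    (hcount : ∀ x, {a | le a x}.Countable) {f : BaireSpc → BaireSpc → BaireSpc}
    (hf : Measurable fun p : BaireSpc × BaireSpc => f p.1 p.2) :
    ∃ g, IsBoldDeltaFun (n + 1) g ∧ ¬ {a | DisjointFun g (f a)}.Countable := by
  have hf' : ∀ {Z : Type} [MeasurableSpace Z] {u v : Z → BaireSpc}, Measurable u → Measurable v →
      Measurable fun z => f (u z) (v z) := fun hu hv => hf.comp (hu.prodMk hv)
  have hW : ¬ (univ : Set BaireSpc).Countable :=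
    fun h => IsBoldSigma.baire_not_countable (countable_univ_iff.1 h)
  have hunc : ¬ Countable (BaireSpc × BaireSpc) := fun _ =>
    IsBoldSigma.baire_not_countable
      (Function.Injective.countable (f := fun x : BaireSpc => (x, x)) fun _ _ h => (Prod.ext_iff.1 h).1)
  let e : BaireSpc ≃ᵐ BaireSpc × BaireSpc :=
    PolishSpace.measurableEquivOfNotCountable IsBoldSigma.baire_not_countable hunc
  obtain ⟨μ, _, _, hμ⟩ := exists_noAtoms_measure_baire
  have hfib : ∀ x y, MeasurableSet {a | f a x = y} := fun x y =>
    measurableSet_eq_fun (hf' measurable_id measurable_const) measurable_const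
  -- Through `e`, a real `c` codes a value `(e c).1` of `g` and an index `(e c).2`. Null fibres
  -- belong to `U` so that later indices can avoid them.
  obtain ⟨h, hgraph, hU, hV⟩ := hle.exists_recursion hcount
    (U := fun x c => μ {a | f a x = (e c).1} = 0 ∧ f (e c).2 x ≠ (e c).1)
    (V := fun x c x' c' => f (e c').2 x ≠ (e c).1 ∧ f (e c).2 x' ≠ (e c').1 ∧ (e c).2 ≠ (e c').2)
    (by
      refine .inter ?_ (measurableSet_eq_fun (hf' (by fun_prop) (by fun_prop)) (by fun_prop)).compl
      exact measurable_measure_prodMk_left (ν := μ)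
        (s := {q : (BaireSpc × BaireSpc) × BaireSpc | f q.2 q.1.1 = (e q.1.2).1})
        (measurableSet_eq_fun (hf' (by fun_prop) (by fun_prop)) (by fun_prop))
        (measurableSet_singleton 0))
    (by
      refine .inter ?_ (.inter ?_ ?_)
      · exact (measurableSet_eq_fun (hf' (by fun_prop) (by fun_prop)) (by fun_prop)).compl
      · exact (measurableSet_eq_fun (hf' (by fun_prop) (by fun_prop)) (by fun_prop)).compl
      · exact (measurableSet_eq_fun (by fun_prop) (by fun_prop)).compl)
    (by
      intro x S h hS hSU
      have hpos : {y | 0 < μ {a | f a x = y}}.Countable :=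
        Measure.countable_meas_pos_of_disjoint_iUnion (fun y => hfib x y) fun y z hyz =>
          Set.disjoint_left.2 fun a hay haz => hyz (hay.symm.trans haz)
      obtain ⟨y, hy⟩ : ∃ y, y ∉ {y | 0 < μ {a | f a x = y}} ∪ (fun x' => f (e (h x')).2 x) '' S := by
        by_contra! hall
        exact hW ((hpos.union (hS.image _)).mono fun y _ => hall y)
      simp only [mem_union, mem_ofPred_eq, mem_image, not_or, not_lt, nonpos_iff_eq_zero,
        not_exists, not_and] at hy
      -- The forbidden indices form a null set: countably many null fibres and a countable set, null
      -- as `μ` has no atoms.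
      obtain ⟨a, ha⟩ : ∃ a, a ∉ {a | f a x = y} ∪
          ((⋃ x' ∈ S, {a | f a x' = (e (h x')).1}) ∪ (fun x' => (e (h x')).2) '' S) := by
        by_contra! hall
        refine hμ (measure_mono_null (fun a _ => hall a) (measure_union_null hy.1
          (measure_union_null ((measure_biUnion_null_iff hS).2 fun x' hx' => (hSU x' hx').1)
            ((hS.image _).measure_zero μ))))
      simp only [mem_union, mem_ofPred_eq, mem_iUnion, mem_image, not_or, not_exists,
        not_and] at ha
      refine ⟨e.symm (y, a), ?_⟩
      simp only [MeasurableEquiv.apply_symm_apply]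
      exact ⟨⟨hy.1, ha.1⟩, fun x' hx' => ⟨hy.2 x' hx', ha.2.1 x' hx',
        fun h => ha.2.2 x' hx' h.symm⟩⟩)
  have hinj : Function.Injective fun x => (e (h x)).2 := by
    intro x x' hxx'
    by_contra hne
    rcases hle.wellOrdering.total x x' with hl | hl
    · exact (hV x' x hl hne).2.2 hxx'.symm
    · exact (hV x x' hl (Ne.symm hne)).2.2 hxx'
  refine ⟨fun x => (e (h x)).1, .of_graph ?_, fun hc => ?_⟩
  · have := IsBoldSigma.exists_baire (n := n) (X := BaireSpc × BaireSpc)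
      (P := fun c p => h p.1 = c ∧ (e c).1 = p.2) (.and
        (hgraph.preimage (f := fun q : (BaireSpc × BaireSpc) × BaireSpc => (q.1.1, q.2))
          (by fun_prop))
        ((measurableSet_eq_fun (by fun_prop) (by fun_prop)).isBoldSigma n))
    convert this using 1
    ext p
    simp
  · have hr := hc.mono (s₁ := range fun x => (e (h x)).2) ?_
    · refine hW ?_
      have := hr.preimage_of_injOn (f := fun x => (e (h x)).2) hinj.injOn
      rwa [preimage_range] at this
    -- The index chosen at `x'` is safe at `x = x'` by `U`, at later `x` by the first clause of `V`,
    -- at earlier `x` by the second.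
    rintro _ ⟨x', rfl⟩ x hx
    by_cases hxx : x' = x
    · subst hxx
      exact (hU x').2 hx.symm
    rcases hle.wellOrdering.total x' x with hl | hl
    · exact (hV x x' hl hxx).1 hx.symm
    · exact (hV x' x hl (Ne.symm hxx)).2.1 hx.symm

theorem exists_disjointFun (hle : IsSigmaGood (n + 2) le) {f : BaireSpc → BaireSpc → BaireSpc}
    (hf : Measurable fun p : BaireSpc × BaireSpc => f p.1 p.2) :
    ∃ g, IsBoldDeltaFun (n + 2) g ∧ ¬ {a | DisjointFun g (f a)}.Countable := by
  by_cases hcount : ∀ x, {a | le a x}.Countable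
  · exact hle.exists_disjointFun_of_countable hcount hf
  · obtain ⟨a₀, ha₀⟩ := not_forall.1 hcount
    exact hle.exists_disjointFun_of_not_countable ha₀ hf

end IsSigmaGood

theorem mainTheorem10 :
    ((∃ le : BaireSpc → BaireSpc → Prop, IsSigmaGood 2 le) →
      ∀ f : BaireSpc → BaireSpc → BaireSpc,
        Measurable (fun p : BaireSpc × BaireSpc => f p.1 p.2) →
        ∃ g : BaireSpc → BaireSpc, IsBoldDeltaFun 2 g ∧
          ¬ {a : BaireSpc | DisjointFun g (f a)}.Countable) ∧
    ((∃ le : BaireSpc → BaireSpc → Prop, IsSigmaGood 3 le) →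
      ∀ f : BaireSpc → BaireSpc → BaireSpc,
        Measurable (fun p : BaireSpc × BaireSpc => f p.1 p.2) →
        ∃ g : BaireSpc → BaireSpc, IsBoldDeltaFun 3 g ∧
          ¬ {a : BaireSpc | DisjointFun g (f a)}.Countable) :=
  ⟨fun ⟨_, hle⟩ _ hf => hle.exists_disjointFun hf, fun ⟨_, hle⟩ _ hf => hle.exists_disjointFun hf⟩
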